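/- Let $H$ be a complex Hilbert space. A graph in $H$ is a linear subspace $A \subset H \times H$. For $z \in \mathbb{C}$ put $A + zI = \{(x, y + zx) : (x,y) \in A\}$ and for $c \in \mathbb{C}$ put $cA = \{(x, cy) : (x,y) \in A\}$. A graph $A$ is called invertible if it is closed in $H \times H$ and for every $y \in H$ there is exactly one $x \in H$ with $(x,y) \in A$; then $A^{-1}$ denotes the bounded operator $y \mapsto x$. The resolvent set $\rho(A)$ is the set of all $z \in \mathbb{C}$ such that $A - zI$ is invertible. The graph $A$ is called self-adjoint if $(x,y)_H \in \mathbb{R}$ for all $(x,y) \in A$ and if for every $s \in \mathbb{R}\setminus\{0\}$ and $y \in H$ there is an $x \in H$ with $(x,y) \in A + isI$. Let $A, A_1, A_2, \ldots$ be self-adjoint graphs in $H$ which are uniformly bounded below, that is, there is an $\omega \in \mathbb{R}$ such that $(x,y)_H + \omega \|x\|_H^2 \ge 0$ for all $(x,y) \in A$, and for all $(x,y) \in A_n$ and all $n$. Then for every $t > 0$ and every $B \in \{A, A_1, A_2, \ldots\}$ the graph $I + \frac{t}{k} B$ is invertible for all large $k \in \mathbb{N}$, and the strong limit $$e^{-tB}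 = \lim_{k\to\infty} \Big( \big(I + \tfrac{t}{k} B\big)^{-1} \Big)^{k}$$ exists as a bounded operator on $H$. Moreover, the following hold. 1. If $A_n \to A$ in the strong resolvent sense, that is, if there is a $z \in \rho(A) \cap \bigcap_n \rho(A_n)$ such that $\sup_n \|(A_n - zI)^{-1}\| < \infty$ and $(A_n - zI)^{-1} y \to (A - zI)^{-1} y$ for all $y \in H$, then $e^{-tA_n} x \to e^{-tA} x$ for all $t > 0$ and $x \in H$. 2. If $A_n \to A$ in the uniform resolvent sense, that is, if there is a $z \in \rho(A) \cap \bigcap_n \rho(A_n)$ such that $\sup_n \|(A_n - zI)^{-1}\| < \infty$ and $\|(A_n - zI)^{-1} - (A - zI)^{-1}\| \to 0$, then $\|e^{-tA_n} - e^{-tA}\| \to 0$ for all $t > 0$. -/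

import Mathlib

open Filter Topology

noncomputable section

/-- A (linear) graph in `H`, i.e. a possibly multi-valued linear operator:
a linear subspace of `H × H`. -/
abbrev LinearGraph (H : Type*) [NormedAddCommGroup H] [InnerProductSpace ℂ H] : Type _ :=
  Submodule ℂ (H × H)

namespace LinearGraph

section Algebra

variable {H : Type*} [NormedAddCommGroup H] [InnerProductSpace ℂ H]

/-- The range `R(A)` is all of `H`. -/
def IsSurjective (A : LinearGraph H) : Prop := ∀ y : H, ∃ x : H, (x, y) ∈ A

/-- The set `A(x) = {y : (x, y) ∈ A}` has at most one element for every `x`. -/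
def IsSingleValued (A : LinearGraph H) : Prop :=
  ∀ x y y' : H, (x, y) ∈ A → (x, y') ∈ A → y = y'

/-- The reflection `{(y, x) : (x, y) ∈ A}` of `A` in the diagonal. -/
def reflection (A : LinearGraph H) : LinearGraph H :=
  A.map ((LinearMap.snd ℂ H H).prod (LinearMap.fst ℂ H H))

theorem mem_reflection (A : LinearGraph H) (x y : H) :
    (y, x) ∈ A.reflection ↔ (x, y) ∈ A := by
  simp [reflection]

/-- The graph `A` is invertible: its reflection is single-valued, and `A` is surjective and
closed in `H × H`. -/
def IsInvertible (A : LinearGraph H) : Prop :=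
  A.reflection.IsSingleValued ∧ A.IsSurjective ∧ IsClosed (A : Set (H × H))

/-- The graph `A + z I = {(x, y + z x) : (x, y) ∈ A}`. -/
def addScalar (A : LinearGraph H) (z : ℂ) : LinearGraph H :=
  A.map ((LinearMap.fst ℂ H H).prod (LinearMap.snd ℂ H H + z • LinearMap.fst ℂ H H))

theorem mem_addScalar (A : LinearGraph H) (z : ℂ) (p : H × H) :
    p ∈ A.addScalar z ↔ ∃ x y : H, (x, y) ∈ A ∧ p = (x, y + z • x) := by
  simp [addScalar, eq_comm]

/-- The graph `c A = {(x, c y) : (x, y) ∈ A}`. -/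
def scale (c : ℂ) (A : LinearGraph H) : LinearGraph H :=
  A.map ((LinearMap.fst ℂ H H).prod (c • LinearMap.snd ℂ H H))

theorem mem_scale (c : ℂ) (A : LinearGraph H) (p : H × H) :
    p ∈ scale c A ↔ ∃ x y : H, (x, y) ∈ A ∧ p = (x, c • y) := by
  simp [scale, eq_comm]

/-- The resolvent set: all `z` such that `A - z I` is invertible. -/
def resolventSet (A : LinearGraph H) : Set ℂ := {z : ℂ | (A.addScalar (-z)).IsInvertible}

/-- `(x, y)_H` is real for all `(x, y) ∈ A`. -/
def IsSymmetric (A : LinearGraph H) : Prop :=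
  ∀ x y : H, (x, y) ∈ A → (inner ℂ x y).im = 0

/-- `A` is symmetric and `A + i s I` is surjective for all real `s ≠ 0`. -/
def IsSelfAdjointGraph (A : LinearGraph H) : Prop :=
  A.IsSymmetric ∧ ∀ s : ℝ, s ≠ 0 → (A.addScalar (Complex.I * (s : ℂ))).IsSurjective

/-- `(x, y)_H + ω ‖x‖² ≥ 0` for all `(x, y) ∈ A` (used for symmetric `A`, where `(x, y)_H` is
real). -/
def IsBoundedBelowBy (A : LinearGraph H) (ω : ℝ) : Prop :=
  ∀ x y : H, (x, y) ∈ A → 0 ≤ (inner ℂ x y).re + ω * ‖x‖ ^ 2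

end Algebra

section Operators

variable {H : Type*} [NormedAddCommGroup H] [InnerProductSpace ℂ H] [CompleteSpace H]

/-- By the closed graph theorem, an invertible graph is the reflection of the graph of a
bounded operator. -/
theorem IsInvertible.exists_inverse {A : LinearGraph H} (hA : A.IsInvertible) :
    ∃ R : H →L[ℂ] H, ∀ x y : H, (x, y) ∈ A ↔ R y = x := by
  obtain ⟨hs, hr, hc⟩ := hA
  choose f hf using hr
  have huniq : ∀ x y : H, (x, y) ∈ A → f y = x := fun x y h =>
    hs y (f y) x ((A.mem_reflection _ _).2 (hf y)) ((A.mem_reflection _ _).2 h)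
  let L : H →ₗ[ℂ] H :=
    { toFun := f
      map_add' := fun y z => huniq _ _ (A.add_mem (hf y) (hf z))
      map_smul' := fun c y => huniq _ _ (A.smul_mem c (hf y)) }
  have hiff : ∀ x y : H, (x, y) ∈ A ↔ L y = x := fun x y =>
    ⟨huniq x y, fun h => h ▸ hf y⟩
  have hcl : IsClosed (L.graph : Set (H × H)) := by
    have hpre : (L.graph : Set (H × H)) = Prod.swap ⁻¹' (A : Set (H × H)) := by
      ext ⟨y, x⟩
      simp only [SetLike.mem_coe, LinearMap.mem_graph_iff, Set.mem_preimage, Prod.swap_prod_mk,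
        hiff]
      exact eq_comm
    rw [hpre]
    exact hc.preimage continuous_swap
  exact ⟨ContinuousLinearMap.ofIsClosedGraph hcl, hiff⟩

open Classical in
/-- The bounded operator `A⁻¹`, with `A⁻¹ y = x` if `(x, y) ∈ A`, for an invertible graph `A`
(and `0` if `A` is not invertible). -/
def inverse (A : LinearGraph H) : H →L[ℂ] H :=
  if hA : A.IsInvertible then hA.exists_inverse.choose else 0

theorem IsInvertible.inverse_apply_eq_iff {A : LinearGraph H} (hA : A.IsInvertible) (x y : H) :
    A.inverse y = x ↔ (x, y) ∈ A := by
  rw [inverse, dif_pos hA]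
  exact (hA.exists_inverse.choose_spec x y).symm

/-- The resolvent `(A - z I)⁻¹`, for `z ∈ ρ(A)`. -/
def resolventOp (A : LinearGraph H) (z : ℂ) : H →L[ℂ] H := (A.addScalar (-z)).inverse

/-- `A n → B` in the strong resolvent sense: for some `z ∈ ρ(B) ∩ ⋂ n, ρ(A n)` at which the
resolvents of the `A n` are uniformly bounded, `(A n - z I)⁻¹ → (B - z I)⁻¹` strongly. -/
def TendstoStrongResolvent (A : ℕ → LinearGraph H) (B : LinearGraph H) : Prop :=
  ∃ z : ℂ, z ∈ B.resolventSet ∧ (∀ n, z ∈ (A n).resolventSet) ∧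
    (∃ C : ℝ, ∀ n, ‖(A n).resolventOp z‖ ≤ C) ∧
    ∀ y : H, Tendsto (fun n => (A n).resolventOp z y) atTop (𝓝 (B.resolventOp z y))

/-- `A n → B` in the uniform (norm) resolvent sense: the same with convergence of the resolvents
in the operator norm. -/
def TendstoUniformResolvent (A : ℕ → LinearGraph H) (B : LinearGraph H) : Prop :=
  ∃ z : ℂ, z ∈ B.resolventSet ∧ (∀ n, z ∈ (A n).resolventSet) ∧
    (∃ C : ℝ, ∀ n, ‖(A n).resolventOp z‖ ≤ C) ∧
    Tendsto (fun n => (A n).resolventOp z) atTop (𝓝 (B.resolventOp z))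

/-- The graph `I + (t / k) A`. -/
def eulerStep (A : LinearGraph H) (t : ℝ) (k : ℕ) : LinearGraph H :=
  (scale ((t / k : ℝ) : ℂ) A).addScalar 1

/-- `S = lim_{k → ∞} ((I + (t / k) A)⁻¹) ^ k` strongly, where `I + (t / k) A` is invertible for
all large `k`. -/
def IsSemigroupOperator (A : LinearGraph H) (t : ℝ) (S : H →L[ℂ] H) : Prop :=
  (∀ᶠ k : ℕ in atTop, (A.eulerStep t k).IsInvertible) ∧
    ∀ x : H, Tendsto (fun k : ℕ => ((A.eulerStep t k).inverse ^ k) x) atTop (𝓝 (S x))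

open Classical in
/-- The operator `e^{-tA} = lim_{k → ∞} ((I + (t / k) A)⁻¹) ^ k` (and `0` if the limit does not
exist). -/
def semigroup (A : LinearGraph H) (t : ℝ) : H →L[ℂ] H :=
  if h : ∃ S : H →L[ℂ] H, A.IsSemigroupOperator t S then h.choose else 0

end Operators

end LinearGraph

end

noncomputable section

namespace LinearGraph

/-! ### Coercive graphs and surjectivity of shifts -/

section Graphs

variable {H : Type*} [NormedAddCommGroup H] [InnerProductSpace ℂ H]

/-! Everything rests on an Euler approximation with rate `C / k` in operator norm, where `C` depends
only on `ω` and `t`. With `l = |ω| + 1`, the resolvent `R = (A + l)⁻¹` is positive, with spectrum in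
`[0, (l - ω)⁻¹]`, and by the resolvent identity each Euler power is a continuous function of `R`. A
point `r > 0` of the spectrum stands for `r⁻¹ - l` in the spectrum of `A`, so the rate reduces to
the scalar bound `abs_inv_one_add_div_pow_sub_exp_le` on `(1 + s / k)⁻ᵏ - e⁻ˢ`. The Euler powers are
thus norm Cauchy, and the semigroup exists.

For fixed `k` the Euler power is a power of a multiple of one resolvent. The factorization
`inverse_addScalar_sub_inverse_addScalar` carries resolvent convergence from `z` to every real shift
`μ > ω`. As the rate is the same for all graphs, the limits in `n` and `k` may be interchanged. -/

theorem mk_mem_addScalar {A : LinearGraph H} {z : ℂ} {x y : H} :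
    (x, y) ∈ A.addScalar z ↔ (x, y - z • x) ∈ A := by
  rw [mem_addScalar]
  constructor
  · rintro ⟨x', y', h, he⟩
    obtain ⟨rfl, rfl⟩ := Prod.mk.inj he
    simpa using h
  · intro h
    exact ⟨x, _, h, by simp⟩

theorem addScalar_addScalar (A : LinearGraph H) (a b : ℂ) :
    (A.addScalar a).addScalar b = A.addScalar (a + b) := by
  ext ⟨x, y⟩
  rw [mk_mem_addScalar, mk_mem_addScalar, mk_mem_addScalar, add_smul, sub_sub, add_comm]

/-- The graph `A` satisfies the coercivity estimate `c ‖x‖ ≤ ‖y‖` for `(x, y) ∈ A`. -/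
def IsCoerciveBy (A : LinearGraph H) (c : ℝ) : Prop :=
  ∀ x y : H, (x, y) ∈ A → c * ‖x‖ ≤ ‖y‖

theorem IsCoerciveBy.norm_sub_le {A : LinearGraph H} {c : ℝ} (hA : A.IsCoerciveBy c)
    (hc : 0 < c) {x y x' y' : H} (h : (x, y) ∈ A) (h' : (x', y') ∈ A) :
    ‖x - x'‖ ≤ c⁻¹ * ‖y - y'‖ := by
  have := hA _ _ (A.sub_mem h h')
  rw [inv_mul_eq_div, le_div_iff₀ hc, mul_comm]
  exact this

/-- Coercivity makes the inverse map Lipschitz with constant `c⁻¹`, and the graph of a continuous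
map is closed. -/
theorem IsCoerciveBy.isInvertible {A : LinearGraph H} {c : ℝ} (hA : A.IsCoerciveBy c)
    (hc : 0 < c) (hs : A.IsSurjective) : A.IsInvertible := by
  have huniq : ∀ x x' y : H, (x, y) ∈ A → (x', y) ∈ A → x = x' := fun x x' y h h' => by
    have := hA.norm_sub_le hc h h'
    rw [sub_self, norm_zero, mul_zero] at this
    exact sub_eq_zero.1 (norm_le_zero_iff.1 this)
  refine ⟨fun y x x' h h' => huniq x x' y ((A.mem_reflection _ _).1 h)
    ((A.mem_reflection _ _).1 h'), hs, ?_⟩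
  choose f hf using hs
  have hL : LipschitzWith (Real.toNNReal c⁻¹) f :=
    LipschitzWith.of_dist_le_mul fun y y' => by
      rw [dist_eq_norm, dist_eq_norm, Real.coe_toNNReal _ (inv_nonneg.2 hc.le)]
      exact hA.norm_sub_le hc (hf y) (hf y')
  have heq : (A : Set (H × H)) = {p | p.1 = f p.2} := by
    ext ⟨x, y⟩
    exact ⟨fun h => huniq _ _ _ h (hf y), fun h => by
      simp only [Set.mem_ofPred_eq] at h
      exact h ▸ hf y⟩
  rw [heq]
  exact isClosed_eq continuous_fst (hL.continuous.comp continuous_snd)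

/-- A solution is a fixed point of `x ↦ A⁻¹ (y - w x)`, a contraction with constant `‖w‖ / c`. -/
theorem IsCoerciveBy.addScalar_isSurjective [CompleteSpace H] {A : LinearGraph H} {c : ℝ}
    (hA : A.IsCoerciveBy c) (hs : A.IsSurjective) {w : ℂ} (hw : ‖w‖ < c) :
    (A.addScalar w).IsSurjective := by
  intro y
  have hc : 0 < c := (norm_nonneg w).trans_lt hw
  choose f hf using hs
  have hcon : ContractingWith (Real.toNNReal (c⁻¹ * ‖w‖)) (fun x => f (y - w • x)) := by
    refine ⟨?_, LipschitzWith.of_dist_le_mul fun x x' => ?_⟩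
    · rw [Real.toNNReal_lt_one, inv_mul_eq_div, div_lt_one hc]
      exact hw
    · rw [dist_eq_norm, dist_eq_norm, Real.coe_toNNReal _ (by positivity)]
      refine (hA.norm_sub_le hc (hf _) (hf _)).trans_eq ?_
      rw [sub_sub_sub_cancel_left, ← smul_sub, norm_smul, norm_sub_rev x' x, mul_assoc]
  refine ⟨hcon.fixedPoint, mk_mem_addScalar.2 ?_⟩
  have h := hf (y - w • hcon.fixedPoint)
  rwa [show f (y - w • hcon.fixedPoint) = hcon.fixedPoint from hcon.fixedPoint_isFixedPt] at h

theorem IsSymmetric.addScalar_isCoerciveBy_im {A : LinearGraph H} (hA : A.IsSymmetric) (z : ℂ) :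
    (A.addScalar z).IsCoerciveBy |z.im| := by
  intro x y h
  have h1 := hA _ _ (mk_mem_addScalar.1 h)
  have h2 : (inner ℂ x y).im = z.im * ‖x‖ ^ 2 := by
    rw [inner_sub_right, inner_smul_right, inner_self_eq_norm_sq_to_K] at h1
    have : (z * ((‖x‖ : ℂ)) ^ 2).im = z.im * ‖x‖ ^ 2 := by
      rw [← Complex.ofReal_pow, Complex.im_mul_ofReal]
    simp only [Complex.sub_im, Complex.coe_algebraMap] at h1
    linarith
  have h3 : |z.im| * ‖x‖ * ‖x‖ ≤ ‖y‖ * ‖x‖ := by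
    have : |(inner ℂ x y).im| ≤ ‖x‖ * ‖y‖ := (Complex.abs_im_le_norm _).trans (norm_inner_le_norm _ _)
    rw [h2, abs_mul, abs_of_nonneg (sq_nonneg ‖x‖)] at this
    linarith
  rcases (norm_nonneg x).eq_or_lt with h0 | h0
  · rw [← h0, mul_zero]; exact norm_nonneg _
  · exact le_of_mul_le_mul_right h3 h0

theorem IsBoundedBelowBy.re_inner_ge {A : LinearGraph H} {ω : ℝ} (hA : A.IsBoundedBelowBy ω)
    {z : ℂ} {x y : H} (h : (x, y) ∈ A.addScalar z) :
    (z.re - ω) * ‖x‖ ^ 2 ≤ (inner ℂ x y).re := by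
  have h1 := hA _ _ (mk_mem_addScalar.1 h)
  rw [inner_sub_right, inner_smul_right, inner_self_eq_norm_sq_to_K] at h1
  have : (z * ((‖x‖ : ℂ)) ^ 2).re = z.re * ‖x‖ ^ 2 := by
    rw [← Complex.ofReal_pow, Complex.re_mul_ofReal]
  simp only [Complex.sub_re, Complex.coe_algebraMap] at h1
  linarith

theorem IsBoundedBelowBy.addScalar_isCoerciveBy_re {A : LinearGraph H} {ω : ℝ}
    (hA : A.IsBoundedBelowBy ω) (z : ℂ) : (A.addScalar z).IsCoerciveBy (z.re - ω) := by
  intro x y h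
  have h3 : (z.re - ω) * ‖x‖ * ‖x‖ ≤ ‖y‖ * ‖x‖ := by
    have : (inner ℂ x y).re ≤ ‖x‖ * ‖y‖ :=
      (Complex.re_le_norm _).trans (norm_inner_le_norm _ _)
    linarith [hA.re_inner_ge h]
  rcases (norm_nonneg x).eq_or_lt with h0 | h0
  · rw [← h0, mul_zero]; exact norm_nonneg _
  · exact le_of_mul_le_mul_right h3 h0

theorem IsSelfAdjointGraph.addScalar_isSurjective_of_im_pos [CompleteSpace H] {A : LinearGraph H}
    (hA : A.IsSelfAdjointGraph) {z : ℂ} (hz : 0 < z.im) : (A.addScalar z).IsSurjective := by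
  -- With `s = |z|² / Im z`, `|z - is|² = s² - |z|² < s²`, so `z` lies within the coercivity radius
  -- `s` around `is`.
  set s : ℝ := (z.re ^ 2 + z.im ^ 2) / z.im with hs
  have hs0 : 0 < s := by positivity
  have hsz : s * z.im = z.re ^ 2 + z.im ^ 2 := by rw [hs]; field_simp
  have hI : (Complex.I * (s : ℂ)).im = s := by simp
  have hc := hA.1.addScalar_isCoerciveBy_im (Complex.I * (s : ℂ))
  rw [hI, abs_of_pos hs0] at hc
  have := hc.addScalar_isSurjective (hA.2 s hs0.ne') (w := z - Complex.I * s) (by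
    refine lt_of_pow_lt_pow_left₀ 2 hs0.le ?_
    rw [Complex.sq_norm, Complex.normSq_apply]
    simp only [Complex.sub_re, Complex.mul_re, Complex.I_re, Complex.I_im, Complex.ofReal_re,
      Complex.ofReal_im, Complex.sub_im, Complex.mul_im, zero_mul, mul_zero, one_mul, sub_zero,
      zero_add]
    nlinarith [mul_pos hz hz, sq_nonneg z.re])
  rwa [addScalar_addScalar, add_sub_cancel] at this

theorem IsSelfAdjointGraph.addScalar_isSurjective_of_lt [CompleteSpace H] {A : LinearGraph H}
    (hA : A.IsSelfAdjointGraph) {ω μ : ℝ} (hω : A.IsBoundedBelowBy ω) (hμ : ω < μ) :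
    (A.addScalar (μ : ℂ)).IsSurjective := by
  -- The shift `μ + is` has coercivity constant `μ - ω`, so any `s` strictly between `0` and `μ - ω`
  -- allows the return to `μ`.
  set s : ℝ := (μ - ω) / 2 with hs
  have hs0 : 0 < s := by rw [hs]; linarith
  have hc := hω.addScalar_isCoerciveBy_re (μ + Complex.I * (s : ℂ))
  have := hc.addScalar_isSurjective (w := -(Complex.I * s))
    (hA.addScalar_isSurjective_of_im_pos (by simpa using hs0)) (by
      simp [abs_of_pos hs0]; linarith)
  rwa [addScalar_addScalar, add_neg_cancel_right] at this

theorem IsSelfAdjointGraph.addScalar_isInvertible [CompleteSpace H] {A : LinearGraph H}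
    (hA : A.IsSelfAdjointGraph) {ω μ : ℝ} (hω : A.IsBoundedBelowBy ω) (hμ : ω < μ) :
    (A.addScalar (μ : ℂ)).IsInvertible :=
  (hω.addScalar_isCoerciveBy_re _).isInvertible (by simpa using hμ)
    (hA.addScalar_isSurjective_of_lt hω hμ)

theorem mk_mem_eulerStep {A : LinearGraph H} {t : ℝ} {k : ℕ} (ht : 0 < t) (hk : 0 < k) {x y : H} :
    (x, y) ∈ A.eulerStep t k ↔ (x, ((k / t : ℝ) : ℂ) • y) ∈ A.addScalar ((k / t : ℝ) : ℂ) := by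
  have hk' : (k : ℂ) ≠ 0 := by exact_mod_cast hk.ne'
  have ht' : (t : ℂ) ≠ 0 := by exact_mod_cast ht.ne'
  have h1 : ((k / t : ℝ) : ℂ) * ((t / k : ℝ) : ℂ) = 1 := by push_cast; field_simp
  have h2 : ((t / k : ℝ) : ℂ) * ((k / t : ℝ) : ℂ) = 1 := by push_cast; field_simp
  rw [eulerStep, mk_mem_addScalar, mk_mem_addScalar, mem_scale, one_smul, ← smul_sub]
  constructor
  · rintro ⟨x', y', h, he⟩
    obtain ⟨rfl, he'⟩ := Prod.mk.inj he
    rwa [he', smul_smul, h1, one_smul]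
  · intro h
    exact ⟨x, _, h, by rw [smul_smul, h2, one_smul]⟩

end Graphs

/-! ### Resolvent identities and Euler steps -/

section Resolvents

variable {H : Type*} [NormedAddCommGroup H] [InnerProductSpace ℂ H] [CompleteSpace H]

theorem IsInvertible.inverse_mem {A : LinearGraph H} (hA : A.IsInvertible) (y : H) :
    (A.inverse y, y) ∈ A :=
  (hA.inverse_apply_eq_iff _ _).1 rfl

theorem IsCoerciveBy.norm_inverse_le {A : LinearGraph H} {c : ℝ} (h : A.IsCoerciveBy c)
    (hc : 0 < c) (hA : A.IsInvertible) : ‖A.inverse‖ ≤ c⁻¹ :=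
  ContinuousLinearMap.opNorm_le_bound _ (inv_nonneg.2 hc.le) fun y => by
    rw [inv_mul_eq_div, le_div_iff₀ hc, mul_comm]
    exact h _ _ (hA.inverse_mem y)

/-- The resolvent identity. -/
theorem inverse_addScalar_mul {A : LinearGraph H} {a b : ℂ} (ha : (A.addScalar a).IsInvertible)
    (hb : (A.addScalar b).IsInvertible) :
    (A.addScalar a).inverse * (1 + (a - b) • (A.addScalar b).inverse) =
      (A.addScalar b).inverse := by
  ext y
  refine (ha.inverse_apply_eq_iff _ _).2 (mk_mem_addScalar.2 ?_)
  have h := mk_mem_addScalar.1 (hb.inverse_mem y)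
  convert h using 2
  change y + (a - b) • (A.addScalar b).inverse y - a • (A.addScalar b).inverse y = _
  rw [sub_smul]
  abel

theorem mul_inverse_addScalar {A : LinearGraph H} {a b : ℂ} (ha : (A.addScalar a).IsInvertible)
    (hb : (A.addScalar b).IsInvertible) :
    (1 + (a - b) • (A.addScalar b).inverse) * (A.addScalar a).inverse =
      (A.addScalar b).inverse := by
  ext y
  set x := (A.addScalar a).inverse y with hx
  have h : (x, y - (a - b) • x) ∈ A.addScalar b := by
    rw [mk_mem_addScalar, sub_sub, ← add_smul, sub_add_cancel, ← mk_mem_addScalar]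
    exact ha.inverse_mem y
  have h' := (hb.inverse_apply_eq_iff _ _).2 h
  rw [map_sub, map_smul, sub_eq_iff_eq_add] at h'
  exact h'.symm

/-- The difference at `a` is placed between a left factor involving only `A` and a right factor
involving only `B`. With `A` running through a sequence, the left factor needs only a uniform bound
and the right one is fixed, so strong convergence passes from `a` to `b`. -/
theorem inverse_addScalar_sub_inverse_addScalar {A B : LinearGraph H} {a b : ℂ}
    (hAa : (A.addScalar a).IsInvertible) (hAb : (A.addScalar b).IsInvertible)
    (hBa : (B.addScalar a).IsInvertible) (hBb : (B.addScalar b).IsInvertible) :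
    (A.addScalar b).inverse - (B.addScalar b).inverse =
      (1 + (a - b) • (A.addScalar b).inverse) *
        (((A.addScalar a).inverse - (B.addScalar a).inverse) *
          (1 + (a - b) • (B.addScalar b).inverse)) := by
  rw [sub_mul, inverse_addScalar_mul hBa hBb, mul_sub, ← mul_assoc, mul_inverse_addScalar hAa hAb,
    mul_add, add_mul, mul_one, one_mul, mul_smul_comm, smul_mul_assoc]
  abel

theorem IsSelfAdjointGraph.eulerStep_isInvertible {A : LinearGraph H}
    (hA : A.IsSelfAdjointGraph) {ω t : ℝ} {k : ℕ} (hω : A.IsBoundedBelowBy ω) (ht : 0 < t)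
    (hk : 0 < k) (hkω : ω < k / t) : (A.eulerStep t k).IsInvertible := by
  have hkt : (0 : ℝ) < k / t := by positivity
  refine IsCoerciveBy.isInvertible (c := (k / t - ω) / (k / t)) (fun x y h => ?_)
    (div_pos (sub_pos.2 hkω) hkt) fun y => ?_
  · have := hω.addScalar_isCoerciveBy_re _ _ _ ((mk_mem_eulerStep ht hk).1 h)
    rw [norm_smul, Complex.norm_real, Real.norm_of_nonneg hkt.le, Complex.ofReal_re] at this
    rwa [div_mul_eq_mul_div, div_le_iff₀ hkt, mul_comm ‖y‖]
  · obtain ⟨x, hx⟩ := hA.addScalar_isSurjective_of_lt hω hkω (((k / t : ℝ) : ℂ) • y)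
    exact ⟨x, (mk_mem_eulerStep ht hk).2 hx⟩

theorem IsSelfAdjointGraph.inverse_eulerStep {A : LinearGraph H}
    (hA : A.IsSelfAdjointGraph) {ω t : ℝ} {k : ℕ} (hω : A.IsBoundedBelowBy ω) (ht : 0 < t)
    (hk : 0 < k) (hkω : ω < k / t) :
    (A.eulerStep t k).inverse =
      ((k / t : ℝ) : ℂ) • (A.addScalar ((k / t : ℝ) : ℂ)).inverse := by
  ext y
  rw [(hA.eulerStep_isInvertible hω ht hk hkω).inverse_apply_eq_iff, mk_mem_eulerStep ht hk,
    smul_apply, ← map_smul]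
  exact (hA.addScalar_isInvertible hω hkω).inverse_mem _

end Resolvents

/-! ### The scalar Euler estimate -/

/-- The scalar estimate behind the Euler approximation of the exponential. -/
theorem abs_inv_one_add_div_pow_sub_exp_le {c s : ℝ} (hc : 0 ≤ c) (hs : -c ≤ s) {k : ℕ}
    (hk : 2 ≤ k) (hck : 2 * c ≤ k) :
    |((1 + s / k)⁻¹) ^ k - Real.exp (-s)| ≤ (4 + c ^ 2 * Real.exp (2 * c)) / k := by
  have hk0 : (0 : ℝ) < k := by exact_mod_cast (by omega : 0 < k)
  have hk2 : (2 : ℝ) ≤ k := by exact_mod_cast hk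
  set x : ℝ := s / k with hx
  have hsx : s = k * x := by rw [hx]; field_simp
  have hx1 : -(1 / 2) ≤ x := by
    rw [hx, le_div_iff₀ hk0]; linarith
  have hpos : 0 < 1 + x := by linarith
  have hexp : Real.exp (-s) = Real.exp (-x) ^ k := by
    rw [← Real.exp_nat_mul, hsx, mul_neg]
  have hle : Real.exp (-x) ≤ (1 + x)⁻¹ := by
    rw [Real.exp_neg]
    exact inv_anti₀ hpos (by linarith [Real.add_one_le_exp x])
  have hdiff : (1 + x)⁻¹ - Real.exp (-x) ≤ x ^ 2 * (1 + x)⁻¹ := by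
    have h1 := Real.add_one_le_exp (-x)
    have h2 : (1 + x)⁻¹ - (1 - x) = x ^ 2 * (1 + x)⁻¹ := by field_simp; ring
    linarith
  -- Telescoping `aᵏ - bᵏ` with `0 < b ≤ a = (1 + x)⁻¹` bounds it by `k aᵏ⁻¹ (a - b)`.
  have hmain : ((1 + x)⁻¹) ^ k - Real.exp (-s) ≤ s ^ 2 / k * ((1 + x)⁻¹) ^ k := by
    have hb0 := Real.exp_pos (-x)
    have ha0 : 0 < (1 + x)⁻¹ := inv_pos.2 hpos
    have hg : ((1 + x)⁻¹) ^ k - Real.exp (-x) ^ k ≤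
        k * ((1 + x)⁻¹) ^ (k - 1) * ((1 + x)⁻¹ - Real.exp (-x)) := by
      rw [← (Commute.all _ _).geom_sum₂_mul]
      refine mul_le_mul_of_nonneg_right ?_ (sub_nonneg.2 hle)
      calc ∑ i ∈ Finset.range k, ((1 + x)⁻¹) ^ i * Real.exp (-x) ^ (k - 1 - i)
          ≤ ∑ _i ∈ Finset.range k, ((1 + x)⁻¹) ^ (k - 1) := by
            refine Finset.sum_le_sum fun i hi => ?_
            have hi' : i + (k - 1 - i) = k - 1 := by
              have := Finset.mem_range.1 hi; omega
            rw [← hi', pow_add, hi']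
            gcongr
        _ = _ := by simp
    calc _ ≤ k * ((1 + x)⁻¹) ^ (k - 1) * ((1 + x)⁻¹ - Real.exp (-x)) := hexp ▸ hg
      _ ≤ k * ((1 + x)⁻¹) ^ (k - 1) * (x ^ 2 * (1 + x)⁻¹) := by gcongr
      _ = k * x ^ 2 * (((1 + x)⁻¹) ^ (k - 1) * (1 + x)⁻¹) := by ring
      _ = s ^ 2 / k * ((1 + x)⁻¹) ^ k := by
        rw [pow_sub_one_mul (by omega)]
        congr 1
        rw [hx]; field_simp
  have hnn : 0 ≤ ((1 + x)⁻¹) ^ k - Real.exp (-s) := by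
    rw [hexp]
    exact sub_nonneg.2 (pow_le_pow_left₀ (Real.exp_pos _).le hle k)
  have hsq : s ^ 2 * ((1 + x)⁻¹) ^ k ≤ 4 + c ^ 2 * Real.exp (2 * c) := by
    rcases le_total 0 s with h0 | h0
    · have hx0 : 0 ≤ x := div_nonneg h0 hk0.le
      have hb : s ^ 2 / 4 ≤ (1 + x) ^ k := by
        -- Bernoulli with exponent `k / 2`, which is at least `1` since `k ≥ 2`; squaring yields the
        -- quadratic growth that absorbs `s²`.
        have h1 : 1 + (k / 2 : ℝ) * x ≤ (1 + x) ^ (k / 2 : ℝ) :=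
          one_add_mul_self_le_rpow_one_add (by linarith) (by linarith)
        have h2 : ((1 + x) ^ (k / 2 : ℝ)) ^ 2 = (1 + x) ^ k := by
          rw [← Real.rpow_mul_natCast hpos.le, ← Real.rpow_natCast (1 + x) k]
          congr 1
          push_cast
          ring
        have h3 : 0 ≤ (k / 2 : ℝ) * x := by positivity
        rw [← h2, show s ^ 2 / 4 = ((k / 2 : ℝ) * x) ^ 2 by rw [hsx]; ring]
        exact pow_le_pow_left₀ h3 (by linarith) 2
      have hp : 0 < (1 + x) ^ k := by positivity
      have : s ^ 2 * ((1 + x)⁻¹) ^ k ≤ 4 := by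
        rw [inv_pow, ← div_eq_mul_inv, div_le_iff₀ hp]
        linarith
      linarith [mul_nonneg (sq_nonneg c) (Real.exp_pos (2 * c)).le]
    · have h1 : ((1 + x)⁻¹) ^ k ≤ Real.exp (2 * c) := by
        have hx0 : x ≤ 0 := div_nonpos_of_nonpos_of_nonneg h0 hk0.le
        -- Here `(1 + x)(1 - 2x) = 1 - x(1 + 2x) ≥ 1`, because `-1/2 ≤ x ≤ 0`.
        have h2 : (1 + x)⁻¹ ≤ Real.exp (-2 * x) := by
          rw [inv_le_iff_one_le_mul₀ hpos]
          have := Real.add_one_le_exp (-2 * x)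
          nlinarith
        calc _ ≤ Real.exp (-2 * x) ^ k := pow_le_pow_left₀ (inv_pos.2 hpos).le h2 k
          _ = Real.exp (-2 * s) := by rw [← Real.exp_nat_mul, hsx]; ring_nf
          _ ≤ _ := Real.exp_le_exp.2 (by linarith)
      have h3 : s ^ 2 ≤ c ^ 2 := by nlinarith
      have := mul_le_mul h3 h1 (by positivity) (sq_nonneg c)
      linarith
  rw [abs_of_nonneg hnn]
  calc _ ≤ _ := hmain
    _ = s ^ 2 * ((1 + x)⁻¹) ^ k / k := by ring
    _ ≤ _ := by gcongr

/-! ### Strong convergence of products and powers -/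

theorem tendsto_mul_apply {E : Type*} [NormedAddCommGroup E] [NormedSpace ℂ E]
    {T S : ℕ → E →L[ℂ] E} {T₀ S₀ : E →L[ℂ] E} {C : ℝ}
    (hC : ∀ n, ‖T n‖ ≤ C) (hT : ∀ x, Tendsto (fun n => T n x) atTop (𝓝 (T₀ x)))
    (hS : ∀ x, Tendsto (fun n => S n x) atTop (𝓝 (S₀ x))) (x : E) :
    Tendsto (fun n => (T n * S n) x) atTop (𝓝 ((T₀ * S₀) x)) := by
  have h1 : Tendsto (fun n => T n (S n x - S₀ x)) atTop (𝓝 0) := by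
    have h0 := ((tendsto_iff_norm_sub_tendsto_zero.1 (hS x)).const_mul C)
    rw [mul_zero] at h0
    exact squeeze_zero_norm (fun n => (T n).le_of_opNorm_le (hC n) _) h0
  have h2 := h1.add (hT (S₀ x))
  rw [zero_add] at h2
  refine h2.congr fun n => ?_
  rw [← map_add, sub_add_cancel]
  rfl

theorem tendsto_pow_apply {E : Type*} [NormedAddCommGroup E] [NormedSpace ℂ E]
    {T : ℕ → E →L[ℂ] E} {T₀ : E →L[ℂ] E} {C : ℝ}
    (hC : ∀ n, ‖T n‖ ≤ C) (hT : ∀ x, Tendsto (fun n => T n x) atTop (𝓝 (T₀ x))) (k : ℕ) (x : E) :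
    Tendsto (fun n => (T n ^ k) x) atTop (𝓝 ((T₀ ^ k) x)) := by
  induction k generalizing x with
  | zero => simp
  | succ k ih =>
    simp only [pow_succ']
    exact tendsto_mul_apply hC hT ih x

/-! ### Functional calculus of a reference resolvent -/

section

variable {H : Type*} [NormedAddCommGroup H] [InnerProductSpace ℂ H] [CompleteSpace H]

theorem isPositive_inverse_addScalar {A : LinearGraph H} (hA : A.IsSymmetric) {ω l : ℝ}
    (hω : A.IsBoundedBelowBy ω) (hl : ω < l) (hi : (A.addScalar (l : ℂ)).IsInvertible) :
    (A.addScalar (l : ℂ)).inverse.IsPositive := by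
  rw [ContinuousLinearMap.isPositive_iff_complex]
  intro y
  have h := hi.inverse_mem y
  set x := (A.addScalar (l : ℂ)).inverse y
  have him : (inner ℂ x y).im = 0 := by
    have h1 := hA _ _ (mk_mem_addScalar.1 h)
    rw [inner_sub_right, inner_smul_right, inner_self_eq_norm_sq_to_K] at h1
    have : ((l : ℂ) * ((‖x‖ : ℂ)) ^ 2).im = 0 := by
      rw [← Complex.ofReal_pow, ← Complex.ofReal_mul, Complex.ofReal_im]
    simp only [Complex.sub_im, Complex.coe_algebraMap] at h1
    linarith
  refine ⟨Complex.ext rfl him.symm, ?_⟩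
  exact (mul_nonneg (by simpa using hl.le) (sq_nonneg _)).trans (hω.re_inner_ge h)

theorem spectrum_inverse_addScalar_subset {A : LinearGraph H} (hA : A.IsSymmetric) {ω l : ℝ}
    (hω : A.IsBoundedBelowBy ω) (hl : ω < l) (hi : (A.addScalar (l : ℂ)).IsInvertible) :
    spectrum ℝ (A.addScalar (l : ℂ)).inverse ⊆ Set.Icc 0 (l - ω)⁻¹ := by
  intro r hr
  have hp := isPositive_inverse_addScalar hA hω hl hi
  refine ⟨spectrum_nonneg_of_nonneg
    ((ContinuousLinearMap.nonneg_iff_isPositive _).2 hp) hr, ?_⟩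
  have hn : ‖(A.addScalar (l : ℂ)).inverse‖ ≤ (l - ω)⁻¹ :=
    (hω.addScalar_isCoerciveBy_re (l : ℂ)).norm_inverse_le (by simpa using hl) hi
  calc r ≤ ‖r‖ := le_abs_self r
    _ ≤ ‖(A.addScalar (l : ℂ)).inverse‖ * ‖(1 : H →L[ℂ] H)‖ :=
      spectrum.norm_le_norm_mul_of_mem hr
    _ ≤ ‖(A.addScalar (l : ℂ)).inverse‖ * 1 := by
      gcongr
      exact ContinuousLinearMap.norm_id_le
    _ ≤ _ := by rwa [mul_one]

/-- The resolvent identity gives `R_μ (1 + (μ - l) R) = R`. Since the spectrum of `R` is nonnegative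
and `μ ≥ l`, the second factor is inverted within the functional calculus. -/
theorem IsSelfAdjointGraph.inverse_addScalar_eq_cfc {A : LinearGraph H}
    (hA : A.IsSelfAdjointGraph) {ω l μ : ℝ} (hω : A.IsBoundedBelowBy ω) (hl : ω < l)
    (hμ : l ≤ μ) :
    (A.addScalar (μ : ℂ)).inverse =
      cfc (fun r : ℝ => r * (1 + (μ - l) * r)⁻¹) (A.addScalar (l : ℂ)).inverse := by
  have hil := hA.addScalar_isInvertible hω hl
  have hiμ := hA.addScalar_isInvertible hω (hl.trans_le hμ)
  have hsp := spectrum_inverse_addScalar_subset hA.1 hω hl hil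
  have hid := inverse_addScalar_mul hiμ hil
  have hsa : IsSelfAdjoint (A.addScalar (l : ℂ)).inverse :=
    (isPositive_inverse_addScalar hA.1 hω hl hil).isSelfAdjoint
  set R := (A.addScalar (l : ℂ)).inverse
  have hne : ∀ r ∈ spectrum ℝ R, 1 + (μ - l) * r ≠ 0 := fun r hr => by
    have := mul_nonneg (sub_nonneg.2 hμ) (hsp hr).1
    positivity
  have hcont : ContinuousOn (fun r : ℝ => (1 + (μ - l) * r)⁻¹) (spectrum ℝ R) :=
    ContinuousOn.inv₀ (by fun_prop) hne
  have hlin : cfc (fun r : ℝ => 1 + (μ - l) * r) R = 1 + ((μ : ℂ) - l) • R := by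
    rw [cfc_add (hf := by fun_prop) (hg := by fun_prop), cfc_const_one ℝ R,
      cfc_const_mul (μ - l) (fun r : ℝ => r) R (by fun_prop), cfc_id' ℝ R]
    congr 1
    rw [← Complex.ofReal_sub]
    rfl
  have hone : (1 + ((μ : ℂ) - l) • R) * cfc (fun r : ℝ => (1 + (μ - l) * r)⁻¹) R = 1 := by
    rw [← hlin, ← cfc_mul _ _ R (by fun_prop) hcont, ← cfc_const_one ℝ R]
    exact cfc_congr fun r hr => mul_inv_cancel₀ (hne r hr)
  rw [cfc_mul _ _ R (by fun_prop) hcont, cfc_id' ℝ R]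
  conv_lhs => rw [← mul_one (A.addScalar (μ : ℂ)).inverse, ← hone, ← mul_assoc, hid]

/-! ### Euler approximation in operator norm -/

/-- The constant in the `O(1 / k)` estimate for the Euler approximations. -/
def eulerConst (ω t : ℝ) : ℝ := 4 + (t * |ω|) ^ 2 * Real.exp (2 * (t * |ω|))

/-- `k` is large enough for the Euler approximations with lower bound `ω` at time `t`. -/
def IsEulerIndex (ω t : ℝ) (k : ℕ) : Prop := 2 ≤ k ∧ 2 * (t * |ω|) ≤ k ∧ t * (|ω| + 1) ≤ k

theorem eventually_isEulerIndex (ω t : ℝ) : ∀ᶠ k : ℕ in atTop, IsEulerIndex ω t k :=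
  (eventually_ge_atTop 2).and
    ((tendsto_natCast_atTop_atTop.eventually_ge_atTop _).and
      (tendsto_natCast_atTop_atTop.eventually_ge_atTop _))

theorem IsEulerIndex.pos {ω t : ℝ} {k : ℕ} (hk : IsEulerIndex ω t k) : 0 < k := by
  have := hk.1
  omega

theorem IsEulerIndex.le_div {ω t : ℝ} {k : ℕ} (hk : IsEulerIndex ω t k) (ht : 0 < t) :
    |ω| + 1 ≤ k / t := by
  rw [le_div_iff₀ ht, mul_comm]
  exact hk.2.2

theorem IsEulerIndex.lt_div {ω t : ℝ} {k : ℕ} (hk : IsEulerIndex ω t k) (ht : 0 < t) :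
    ω < k / t :=
  ((le_abs_self ω).trans_lt (lt_add_one _)).trans_le (hk.le_div ht)

/-- The reference shift `|ω| + 1` exceeds `ω` and does not depend on `k`, so Euler powers with
different indices become functions of one operator and can be compared pointwise. -/
theorem IsSelfAdjointGraph.inverse_eulerStep_pow_eq_cfc {A : LinearGraph H}
    (hA : A.IsSelfAdjointGraph) {ω t : ℝ} (hω : A.IsBoundedBelowBy ω) (ht : 0 < t) {k : ℕ}
    (hk : IsEulerIndex ω t k) :
    let f : ℝ → ℝ :=
      fun r => (k / t * (r * (1 + (k / t - (|ω| + 1)) * r)⁻¹)) ^ k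
    ContinuousOn f (spectrum ℝ (A.addScalar ((|ω| + 1 : ℝ) : ℂ)).inverse) ∧
    (A.eulerStep t k).inverse ^ k = cfc f (A.addScalar ((|ω| + 1 : ℝ) : ℂ)).inverse := by
  intro f
  have hl : ω < |ω| + 1 := (le_abs_self ω).trans_lt (lt_add_one _)
  have hil := hA.addScalar_isInvertible hω hl
  have hsp := spectrum_inverse_addScalar_subset hA.1 hω hl hil
  have hsa : IsSelfAdjoint (A.addScalar ((|ω| + 1 : ℝ) : ℂ)).inverse :=
    (isPositive_inverse_addScalar hA.1 hω hl hil).isSelfAdjoint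
  rw [hA.inverse_eulerStep hω ht hk.pos (hk.lt_div ht),
    hA.inverse_addScalar_eq_cfc hω hl (hk.le_div ht)]
  set R := (A.addScalar ((|ω| + 1 : ℝ) : ℂ)).inverse
  have hcont : ContinuousOn (fun r : ℝ => r * (1 + (k / t - (|ω| + 1)) * r)⁻¹)
      (spectrum ℝ R) :=
    continuousOn_id.mul (ContinuousOn.inv₀ (by fun_prop) fun r hr => by
      have := mul_nonneg (sub_nonneg.2 (hk.le_div ht)) (hsp hr).1
      positivity)
  have hcont' : ContinuousOn (fun r : ℝ => k / t * (r * (1 + (k / t - (|ω| + 1)) * r)⁻¹))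
      (spectrum ℝ R) := continuousOn_const.mul hcont
  refine ⟨hcont'.pow k, ?_⟩
  rw [show f = fun r => (k / t * (r * (1 + (k / t - (|ω| + 1)) * r)⁻¹)) ^ k from rfl,
    cfc_pow _ k R hcont', cfc_const_mul _ _ R hcont]
  rfl

theorem IsSelfAdjointGraph.norm_inverse_eulerStep_pow_sub_le {A : LinearGraph H}
    (hA : A.IsSelfAdjointGraph) {ω t : ℝ} (hω : A.IsBoundedBelowBy ω) (ht : 0 < t) {j k : ℕ}
    (hj : IsEulerIndex ω t j) (hk : IsEulerIndex ω t k) :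
    ‖(A.eulerStep t j).inverse ^ j - (A.eulerStep t k).inverse ^ k‖ ≤
      eulerConst ω t / j + eulerConst ω t / k := by
  have hl : ω < |ω| + 1 := (le_abs_self ω).trans_lt (lt_add_one _)
  have hil := hA.addScalar_isInvertible hω hl
  have hsp := spectrum_inverse_addScalar_subset hA.1 hω hl hil
  obtain ⟨hcj, hej⟩ := hA.inverse_eulerStep_pow_eq_cfc hω ht hj
  obtain ⟨hck, hek⟩ := hA.inverse_eulerStep_pow_eq_cfc hω ht hk
  have hC : 0 < eulerConst ω t := by rw [eulerConst]; positivity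
  rw [hej, hek, ← cfc_sub _ _ _ hcj hck]
  refine norm_cfc_le (by positivity) fun r hr => ?_
  -- The value `r = 0` reflects the multivalued part: `A(0)` is the kernel of the reference
  -- resolvent. Both functions vanish there, as the exponents are positive.
  rcases (hsp hr).1.eq_or_lt with h0 | h0
  · simp only [← h0, zero_mul, mul_zero, zero_pow hj.pos.ne', zero_pow hk.pos.ne', sub_zero,
      norm_zero]
    positivity
  -- Here `r = (λ + |ω| + 1)⁻¹` and `s = tλ`; the spectral bound on `r` gives `λ ≥ -ω`.
  · set s : ℝ := t * (r⁻¹ - (|ω| + 1)) with hs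
    have hsc : -(t * |ω|) ≤ s := by
      have h1 : |ω| + 1 - ω ≤ r⁻¹ := by
        have := (hsp hr).2
        rwa [le_inv_comm₀ h0 (by linarith)] at this
      rw [hs, ← mul_neg]
      gcongr
      linarith [le_abs_self ω]
    have hval : ∀ i : ℕ, IsEulerIndex ω t i →
        |(i / t * (r * (1 + (i / t - (|ω| + 1)) * r)⁻¹)) ^ i - Real.exp (-s)| ≤
          eulerConst ω t / i := by
      intro i hi
      have hi0 : (0 : ℝ) < i := by exact_mod_cast hi.pos
      have : |((1 + s / i)⁻¹) ^ i - Real.exp (-s)| ≤ eulerConst ω t / i :=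
        abs_inv_one_add_div_pow_sub_exp_le (by positivity) hsc hi.1 hi.2.1
      convert this using 4
      have hpos : 0 < 1 + (i / t - (|ω| + 1)) * r := by
        have := mul_nonneg (sub_nonneg.2 (hi.le_div ht)) h0.le
        positivity
      have he : 1 + s / i = t / (i * r) * (1 + (i / t - (|ω| + 1)) * r) := by
        rw [hs]
        field_simp
        ring
      rw [he, mul_inv, inv_div]
      ring
    rw [Real.norm_eq_abs]
    refine (abs_sub_le _ (Real.exp (-s)) _).trans (add_le_add (hval j hj) ?_)
    rw [abs_sub_comm]
    exact hval k hk

theorem tendsto_eulerConst_div (ω t : ℝ) :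
    Tendsto (fun k : ℕ => eulerConst ω t / k) atTop (𝓝 0) :=
  tendsto_const_div_atTop_nhds_zero_nat _

theorem IsSelfAdjointGraph.exists_isSemigroupOperator {A : LinearGraph H}
    (hA : A.IsSelfAdjointGraph) {ω t : ℝ} (hω : A.IsBoundedBelowBy ω) (ht : 0 < t) :
    ∃ S, A.IsSemigroupOperator t S := by
  have hcau : CauchySeq fun k : ℕ => (A.eulerStep t k).inverse ^ k := by
    rw [Metric.cauchySeq_iff]
    intro ε hε
    have hev := (eventually_isEulerIndex ω t).and
      ((tendsto_eulerConst_div ω t).eventually (gt_mem_nhds (half_pos hε)))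
    obtain ⟨N, hN⟩ := eventually_atTop.1 hev
    refine ⟨N, fun j hj k hk => ?_⟩
    rw [dist_eq_norm]
    have := hA.norm_inverse_eulerStep_pow_sub_le hω ht (hN j hj).1 (hN k hk).1
    linarith [(hN j hj).2, (hN k hk).2]
  obtain ⟨S, hS⟩ := cauchySeq_tendsto_of_complete hcau
  refine ⟨S, ?_, fun x => ((ContinuousLinearMap.apply ℂ H x).continuous.tendsto S).comp hS⟩
  filter_upwards [eventually_isEulerIndex ω t] with k hk
  exact hA.eulerStep_isInvertible hω ht hk.pos (hk.lt_div ht)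

theorem IsSelfAdjointGraph.isSemigroupOperator_semigroup {A : LinearGraph H}
    (hA : A.IsSelfAdjointGraph) {ω t : ℝ} (hω : A.IsBoundedBelowBy ω) (ht : 0 < t) :
    A.IsSemigroupOperator t (A.semigroup t) := by
  have h := hA.exists_isSemigroupOperator hω ht
  rw [semigroup, dif_pos h]
  exact h.choose_spec

/-- The semigroup is specified by a strong limit, so `j → ∞` is taken in the two-index estimate one
vector at a time. -/
theorem IsSelfAdjointGraph.norm_semigroup_sub_le {A : LinearGraph H}
    (hA : A.IsSelfAdjointGraph) {ω t : ℝ} (hω : A.IsBoundedBelowBy ω) (ht : 0 < t) {k : ℕ}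
    (hk : IsEulerIndex ω t k) :
    ‖A.semigroup t - (A.eulerStep t k).inverse ^ k‖ ≤ eulerConst ω t / k := by
  have hC : 0 < eulerConst ω t := by rw [eulerConst]; positivity
  refine ContinuousLinearMap.opNorm_le_bound _ (by positivity) fun x => ?_
  have hlim := (((hA.isSemigroupOperator_semigroup hω ht).2 x).sub_const
    (((A.eulerStep t k).inverse ^ k) x)).norm
  have hlim' := ((tendsto_eulerConst_div ω t).add_const (eulerConst ω t / k)).mul_const ‖x‖
  rw [zero_add] at hlim'
  refine le_of_tendsto_of_tendsto hlim hlim' ?_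
  filter_upwards [eventually_isEulerIndex ω t] with j hj
  exact ((((A.eulerStep t j).inverse ^ j) - (A.eulerStep t k).inverse ^ k).le_opNorm x).trans
    (mul_le_mul_of_nonneg_right (hA.norm_inverse_eulerStep_pow_sub_le hω ht hj hk)
      (norm_nonneg x))

/-! ### Convergence of resolvents and semigroups -/

variable {A : ℕ → LinearGraph H} {B : LinearGraph H} {ω : ℝ}

theorem norm_inverse_addScalar_le
    (hA : ∀ n, (A n).IsSelfAdjointGraph) (hAω : ∀ n, (A n).IsBoundedBelowBy ω) {μ : ℝ}
    (hμ : ω < μ) (n : ℕ) : ‖((A n).addScalar (μ : ℂ)).inverse‖ ≤ (μ - ω)⁻¹ :=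
  ((hAω n).addScalar_isCoerciveBy_re (μ : ℂ)).norm_inverse_le (by simpa using hμ)
    ((hA n).addScalar_isInvertible (hAω n) hμ)

theorem norm_one_add_smul_inverse_addScalar_le
    (hA : ∀ n, (A n).IsSelfAdjointGraph) (hAω : ∀ n, (A n).IsBoundedBelowBy ω) {μ : ℝ}
    (hμ : ω < μ) (w : ℂ) (n : ℕ) :
    ‖1 + w • ((A n).addScalar (μ : ℂ)).inverse‖ ≤ 1 + ‖w‖ * (μ - ω)⁻¹ := by
  refine (norm_add_le _ _).trans (add_le_add ContinuousLinearMap.norm_id_le ?_)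
  rw [norm_smul]
  gcongr
  exact norm_inverse_addScalar_le hA hAω hμ n

theorem TendstoStrongResolvent.tendsto_inverse_addScalar (h : TendstoStrongResolvent A B)
    (hA : ∀ n, (A n).IsSelfAdjointGraph) (hB : B.IsSelfAdjointGraph)
    (hAω : ∀ n, (A n).IsBoundedBelowBy ω) (hBω : B.IsBoundedBelowBy ω) {μ : ℝ} (hμ : ω < μ)
    (x : H) :
    Tendsto (fun n => ((A n).addScalar (μ : ℂ)).inverse x) atTop
      (𝓝 ((B.addScalar (μ : ℂ)).inverse x)) := by
  obtain ⟨z, hzB, hzA, -, hlim⟩ := h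
  rw [tendsto_iff_norm_sub_tendsto_zero]
  -- The right factor of the factorization. It is independent of `n`, so the hypothesis at `z` is
  -- applied to the single vector `P x`.
  set P : H →L[ℂ] H := 1 + (-z - μ) • (B.addScalar (μ : ℂ)).inverse
  have h0 := (tendsto_iff_norm_sub_tendsto_zero.1 (hlim (P x))).const_mul
    (1 + ‖-z - (μ : ℂ)‖ * (μ - ω)⁻¹)
  rw [mul_zero] at h0
  refine squeeze_zero (fun _ => norm_nonneg _) (fun n => ?_) h0
  have he := inverse_addScalar_sub_inverse_addScalar (hzA n)
    ((hA n).addScalar_isInvertible (hAω n) hμ) hzB (hB.addScalar_isInvertible hBω hμ)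
  have he' := congrArg (fun T : H →L[ℂ] H => T x) he
  refine (congrArg norm he').trans_le ?_
  exact ContinuousLinearMap.le_of_opNorm_le _
    (norm_one_add_smul_inverse_addScalar_le hA hAω hμ _ n) _

theorem TendstoUniformResolvent.tendsto_inverse_addScalar (h : TendstoUniformResolvent A B)
    (hA : ∀ n, (A n).IsSelfAdjointGraph) (hB : B.IsSelfAdjointGraph)
    (hAω : ∀ n, (A n).IsBoundedBelowBy ω) (hBω : B.IsBoundedBelowBy ω) {μ : ℝ} (hμ : ω < μ) :
    Tendsto (fun n => ((A n).addScalar (μ : ℂ)).inverse) atTop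
      (𝓝 (B.addScalar (μ : ℂ)).inverse) := by
  obtain ⟨z, hzB, hzA, -, hlim⟩ := h
  rw [tendsto_iff_norm_sub_tendsto_zero]
  set P : H →L[ℂ] H := 1 + (-z - μ) • (B.addScalar (μ : ℂ)).inverse
  have h0 := ((tendsto_iff_norm_sub_tendsto_zero.1 hlim).mul_const ‖P‖).const_mul
    (1 + ‖-z - (μ : ℂ)‖ * (μ - ω)⁻¹)
  rw [zero_mul, mul_zero] at h0
  refine squeeze_zero (fun _ => norm_nonneg _) (fun n => ?_) h0
  rw [inverse_addScalar_sub_inverse_addScalar (hzA n)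
    ((hA n).addScalar_isInvertible (hAω n) hμ) hzB (hB.addScalar_isInvertible hBω hμ)]
  exact (norm_mul_le _ _).trans (mul_le_mul
    (norm_one_add_smul_inverse_addScalar_le hA hAω hμ _ n) (norm_mul_le _ _) (norm_nonneg _)
    ((norm_nonneg _).trans (norm_one_add_smul_inverse_addScalar_le hA hAω hμ (-z - μ) n)))

theorem TendstoStrongResolvent.tendsto_inverse_eulerStep_pow (h : TendstoStrongResolvent A B)
    (hA : ∀ n, (A n).IsSelfAdjointGraph) (hB : B.IsSelfAdjointGraph)
    (hAω : ∀ n, (A n).IsBoundedBelowBy ω) (hBω : B.IsBoundedBelowBy ω) {t : ℝ} (ht : 0 < t)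
    {k : ℕ} (hk : IsEulerIndex ω t k) (x : H) :
    Tendsto (fun n => (((A n).eulerStep t k).inverse ^ k) x) atTop
      (𝓝 (((B.eulerStep t k).inverse ^ k) x)) := by
  have hkω := hk.lt_div ht
  refine tendsto_pow_apply (C := ‖((k / t : ℝ) : ℂ)‖ * (k / t - ω)⁻¹) (fun n => ?_) (fun y => ?_)
    k x
  · rw [(hA n).inverse_eulerStep (hAω n) ht hk.pos hkω, norm_smul]
    gcongr
    exact norm_inverse_addScalar_le hA hAω hkω n
  · simp only [fun n => (hA n).inverse_eulerStep (hAω n) ht hk.pos hkω,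
      hB.inverse_eulerStep hBω ht hk.pos hkω]
    exact (h.tendsto_inverse_addScalar hA hB hAω hBω hkω y).const_smul _

theorem TendstoUniformResolvent.tendsto_inverse_eulerStep_pow (h : TendstoUniformResolvent A B)
    (hA : ∀ n, (A n).IsSelfAdjointGraph) (hB : B.IsSelfAdjointGraph)
    (hAω : ∀ n, (A n).IsBoundedBelowBy ω) (hBω : B.IsBoundedBelowBy ω) {t : ℝ} (ht : 0 < t)
    {k : ℕ} (hk : IsEulerIndex ω t k) :
    Tendsto (fun n => ((A n).eulerStep t k).inverse ^ k) atTop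
      (𝓝 ((B.eulerStep t k).inverse ^ k)) := by
  have hkω := hk.lt_div ht
  simp only [fun n => (hA n).inverse_eulerStep (hAω n) ht hk.pos hkω,
    hB.inverse_eulerStep hBω ht hk.pos hkω]
  exact ((h.tendsto_inverse_addScalar hA hB hAω hBω hkω).const_smul _).pow k

/-- Interchange of limits: sequences that are uniformly approximated by convergent sequences
converge. -/
theorem tendsto_of_forall_exists_approx {E : Type*} [SeminormedAddCommGroup E] {u : ℕ → E} {a : E}
    (h : ∀ ε > 0, ∃ (v : ℕ → E) (b : E), Tendsto v atTop (𝓝 b) ∧ (∀ n, ‖u n - v n‖ ≤ ε) ∧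
      ‖a - b‖ ≤ ε) : Tendsto u atTop (𝓝 a) := by
  rw [Metric.tendsto_atTop]
  intro ε hε
  obtain ⟨v, b, hv, huv, hab⟩ := h (ε / 4) (by positivity)
  obtain ⟨N, hN⟩ := Metric.tendsto_atTop.1 hv (ε / 4) (by positivity)
  refine ⟨N, fun n hn => ?_⟩
  have h1 := dist_triangle4 (u n) (v n) b a
  rw [dist_eq_norm (u n) (v n), dist_comm b a, dist_eq_norm a b] at h1
  linarith [huv n, hN n hn]

theorem TendstoStrongResolvent.tendsto_semigroup (h : TendstoStrongResolvent A B)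
    (hA : ∀ n, (A n).IsSelfAdjointGraph) (hB : B.IsSelfAdjointGraph)
    (hAω : ∀ n, (A n).IsBoundedBelowBy ω) (hBω : B.IsBoundedBelowBy ω) {t : ℝ} (ht : 0 < t)
    (x : H) : Tendsto (fun n => (A n).semigroup t x) atTop (𝓝 (B.semigroup t x)) := by
  refine tendsto_of_forall_exists_approx fun ε hε => ?_
  have hlim := (tendsto_eulerConst_div ω t).mul_const ‖x‖
  rw [zero_mul] at hlim
  -- One `k` serves every `n`, because `eulerConst` involves only the common bound `ω` and `t`.
  obtain ⟨k, hk, hkε⟩ := ((eventually_isEulerIndex ω t).and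
    (hlim.eventually (gt_mem_nhds hε))).exists
  exact ⟨_, _, h.tendsto_inverse_eulerStep_pow hA hB hAω hBω ht hk x,
    fun n => (ContinuousLinearMap.le_of_opNorm_le _
      ((hA n).norm_semigroup_sub_le (hAω n) ht hk) x).trans hkε.le,
    (ContinuousLinearMap.le_of_opNorm_le _ (hB.norm_semigroup_sub_le hBω ht hk) x).trans hkε.le⟩

theorem TendstoUniformResolvent.tendsto_semigroup (h : TendstoUniformResolvent A B)
    (hA : ∀ n, (A n).IsSelfAdjointGraph) (hB : B.IsSelfAdjointGraph)
    (hAω : ∀ n, (A n).IsBoundedBelowBy ω) (hBω : B.IsBoundedBelowBy ω) {t : ℝ} (ht : 0 < t) :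
    Tendsto (fun n => (A n).semigroup t) atTop (𝓝 (B.semigroup t)) := by
  refine tendsto_of_forall_exists_approx fun ε hε => ?_
  obtain ⟨k, hk, hkε⟩ := ((eventually_isEulerIndex ω t).and
    ((tendsto_eulerConst_div ω t).eventually (gt_mem_nhds hε))).exists
  exact ⟨_, _, h.tendsto_inverse_eulerStep_pow hA hB hAω hBω ht hk,
    fun n => ((hA n).norm_semigroup_sub_le (hAω n) ht hk).trans hkε.le,
    (hB.norm_semigroup_sub_le hBω ht hk).trans hkε.le⟩

end

end LinearGraph

end

theorem theorem6p3 {H : Type*} [NormedAddCommGroup H] [InnerProductSpace ℂ H] [CompleteSpace H]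
    (A : ℕ → LinearGraph H) (B : LinearGraph H)
    (hA : ∀ n, (A n).IsSelfAdjointGraph) (hB : B.IsSelfAdjointGraph)
    (ω : ℝ) (hAω : ∀ n, (A n).IsBoundedBelowBy ω) (hBω : B.IsBoundedBelowBy ω) :
    -- the semigroup operators exist, as limits of the Euler approximations
    (∀ t : ℝ, 0 < t → B.IsSemigroupOperator t (B.semigroup t) ∧
      ∀ n, (A n).IsSemigroupOperator t ((A n).semigroup t)) ∧
    (LinearGraph.TendstoStrongResolvent A B → ∀ t : ℝ, 0 < t → ∀ x : H,
      Tendsto (fun n => (A n).semigroup t x) atTop (𝓝 (B.semigroup t x))) ∧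
    (LinearGraph.TendstoUniformResolvent A B → ∀ t : ℝ, 0 < t →
      Tendsto (fun n => (A n).semigroup t) atTop (𝓝 (B.semigroup t))) :=
  ⟨fun _ ht => ⟨hB.isSemigroupOperator_semigroup hBω ht,
      fun n => (hA n).isSemigroupOperator_semigroup (hAω n) ht⟩,
    fun h _ ht x => h.tendsto_semigroup hA hB hAω hBω ht x,
    fun h _ ht => h.tendsto_semigroup hA hB hAω hBω ht⟩
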